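/- Let $N\ge 3$ and $d\ge 2$, and let $|\psi\rangle$ be a Haar-random pure state, i.e. uniformly distributed on the unit sphere of $(\mathbb{C}^d)^{\otimes N}$. For a set $S\subseteq\{1,\dots,N\}$ of qudits and a state $\eta$ on $(\mathbb{C}^d)^{\otimes N}$, let $\eta_S=\operatorname{tr}_{S^c}\eta$ be its marginal on $S$; write $\psi_S$ for the marginal of $|\psi\rangle\langle\psi|$. A state of the qudits in $R$ is *entangled across all cuts* if for every partition $R=A\sqcup B$ into nonempty sets it is not a finite convex combination of tensor products of density matrices on $A$ and on $B$. Say that $k$ is *large* if $k\ge \frac N2+1$ when $d=2$, and if $k>\frac N2$ when $d\ge 3$. For a family $\mathcal G$ of subsets of $\{1,\dots,N\}$, say that the (automatically compatible) marginals $(\psi_S)_{S\in\mathcal G}$ *exhibit entanglement transitivity* if (a) $\psi_S$ is entangled across all cuts for every $S\in\mathcal G$, and (b) for every state $\eta$, pure or mixed, on $(\mathbb{C}^d)^{\otimes N}$ with $\eta_S=\psi_S$ for all $S\in\mathcal G$, and every $R\subseteq\{1,\dots,N\}$ with $R\notin\mathcal G$ and $|R|$ large, the marginal $\eta_R$ is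 entangled across all cuts. 1. Suppose that $d\ge 3$ or $N$ is even. Let $S,T$ be any two sets of $\lfloor\frac N2\rfloor+1$ qudits with $|S\cap T|=2$ if $N$ is even and $|S\cap T|=1$ if $N$ is odd. Then, almost surely, the two marginals $\psi_S,\psi_T$ exhibit entanglement transitivity. 2. Let $K$ be any set of $\lceil\frac N2\rceil$ qudits. Then, almost surely, the $\lfloor\frac N2\rfloor$ marginals $\psi_{K\cup\{j\}}$, $j\notin K$, each on $\lceil\frac N2\rceil+1$ qudits, exhibit entanglement transitivity. -/

import Mathlib

open MeasureTheory Finset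
open scoped Kronecker ComplexOrder

noncomputable section

/-- A density matrix (quantum state, pure or mixed) on the Hilbert space with basis `I`. -/
def IsDensityMatrix {I : Type*} [Fintype I] (ρ : Matrix I I ℂ) : Prop :=
  ρ.PosSemidef ∧ ρ.trace = 1

/-- Separability of a bipartite matrix on `ℂ^I ⊗ ℂ^J`: a finite convex combination of tensor
products of density matrices. -/
def IsSeparableState {I J : Type*} [Fintype I] [Fintype J] (ρ : Matrix (I × J) (I × J) ℂ) : Prop :=
  ∃ (n : ℕ) (p : Fin n → ℝ) (σ : Fin n → Matrix I I ℂ) (τ : Fin n → Matrix J J ℂ),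
    (∀ i, 0 ≤ p i) ∧ ∑ i, p i = 1 ∧
    (∀ i, IsDensityMatrix (σ i)) ∧ (∀ i, IsDensityMatrix (τ i)) ∧
    ρ = ∑ i, (p i : ℂ) • (σ i ⊗ₖ τ i)

/-- The basis of `(ℂ^d)^{⊗ ι}` is `ι → Fin d`. For a set `S` of parties, this is the
identification of this basis with the one of `(ℂ^d)^{⊗ S} ⊗ (ℂ^d)^{⊗ Sᶜ}`. -/
def splitEquiv {ι : Type*} [DecidableEq ι] (d : ℕ) (S : Finset ι) :
    (ι → Fin d) ≃ ({i // i ∈ S} → Fin d) × ({i // i ∉ S} → Fin d) :=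
  Equiv.piEquivPiSubtypeProd (fun i => i ∈ S) (fun _ => Fin d)

/-- The marginal on the parties in `S`: the partial trace over the parties outside `S`. -/
def marginal {ι : Type*} [Fintype ι] [DecidableEq ι] {d : ℕ} (S : Finset ι)
    (ρ : Matrix (ι → Fin d) (ι → Fin d) ℂ) :
    Matrix ({i // i ∈ S} → Fin d) ({i // i ∈ S} → Fin d) ℂ :=
  fun x y => ∑ z : {i // i ∉ S} → Fin d,
    ρ ((splitEquiv d S).symm (x, z)) ((splitEquiv d S).symm (y, z))

/-- The state `ρ` of the parties `ι` is entangled (i.e. not separable) across the cut `A | Aᶜ`. -/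
def EntangledAcross {ι : Type*} [Fintype ι] [DecidableEq ι] {d : ℕ}
    (ρ : Matrix (ι → Fin d) (ι → Fin d) ℂ) (A : Finset ι) : Prop :=
  ¬ IsSeparableState (Matrix.reindex (splitEquiv d A) (splitEquiv d A) ρ)

/-- Entanglement across every bipartition of the parties `ι` into two nonempty groups. -/
def EntangledAcrossAllCuts {ι : Type*} [Fintype ι] [DecidableEq ι] {d : ℕ}
    (ρ : Matrix (ι → Fin d) (ι → Fin d) ℂ) : Prop :=
  ∀ A : Finset ι, A.Nonempty → A ≠ Finset.univ → EntangledAcross ρ A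

/-- The global state `η` (pure or mixed) has, for every `S` in the family `G`, the prescribed
marginal `σ S`. -/
def IsCompatible {N d : ℕ} (G : Finset (Finset (Fin N)))
    (σ : (S : Finset (Fin N)) → Matrix ({i // i ∈ S} → Fin d) ({i // i ∈ S} → Fin d) ℂ)
    (η : Matrix (Fin N → Fin d) (Fin N → Fin d) ℂ) : Prop :=
  IsDensityMatrix η ∧ ∀ S ∈ G, marginal S η = σ S

/-- The given states `σ S`, `S ∈ G`, exhibit entanglement transitivity in the target sets `T`:
they are compatible, each is entangled across all cuts, and every global state compatible with
them has, on every target set, a marginal which is entangled across all cuts. -/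
structure ExhibitsTransitivity {N d : ℕ} (G : Finset (Finset (Fin N)))
    (σ : (S : Finset (Fin N)) → Matrix ({i // i ∈ S} → Fin d) ({i // i ∈ S} → Fin d) ℂ)
    (T : Set (Finset (Fin N))) : Prop where
  compatible : ∃ η, IsCompatible G σ η
  given_entangled : ∀ S ∈ G, EntangledAcrossAllCuts (σ S)
  forced_entangled : ∀ η, IsCompatible G σ η → ∀ R ∈ T, EntangledAcrossAllCuts (marginal R η)

/-- The size threshold for entanglement across all cuts: `k ≥ N / 2 + 1` for qubits (where a cut
splitting off one qubit always occurs), and `k > N / 2` for `d ≥ 3`. -/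
def SizeThreshold (d N k : ℕ) : Prop :=
  if d = 2 then N + 2 ≤ 2 * k else N < 2 * k

/-- The remaining sets of parties, i.e. those not in `G`, whose size satisfies the threshold. -/
def remainingLarge (d : ℕ) {N : ℕ} (G : Finset (Finset (Fin N))) : Set (Finset (Fin N)) :=
  {R | R ∉ G ∧ SizeThreshold d N R.card}

/-- The Hilbert space `(ℂ^d)^{⊗ N}` of `N` qudits, in the product basis. -/
abbrev QuditSpace (N d : ℕ) : Type := EuclideanSpace ℂ (Fin N → Fin d)

/-- The uniform (Haar) probability measure on the unit sphere of `(ℂ^d)^{⊗ N}`: the normalized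
surface measure. -/
def haarPureState (N d : ℕ) : Measure (Metric.sphere (0 : QuditSpace N d) 1) :=
  ((volume : Measure (QuditSpace N d)).toSphere Set.univ)⁻¹ •
    (volume : Measure (QuditSpace N d)).toSphere

/-- The density matrix `|ψ⟩⟨ψ|`. -/
def pureDensity {N d : ℕ} (ψ : QuditSpace N d) : Matrix (Fin N → Fin d) (Fin N → Fin d) ℂ :=
  Matrix.of fun x y => ψ x * star (ψ y)

end

/-! Almost surely two things happen: every large marginal of `ψ` is entangled across all cuts, and
`ψ` is determined by the given marginals among all states, pure or mixed. A compatible `η` then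
equals `|ψ⟩⟨ψ|`, so its large marginals are entangled (`exhibitsTransitivity_of_unique`).

Entanglement: the range of a separable state contains a product vector. The range of `ψ_R` is
spanned by the slices of `ψ` indexed by configurations outside `R`, and a parameter count
(`ae_no_product_vector`) shows that generic slices span no product vector once `d^c ≤ (d^a - 1)(d^b
- 1)`, where `a`, `b`, `c` are the sizes of the two sides of the cut and of the complement of `R`.
The size threshold guarantees this.

Uniqueness: write `η = Φ Φᴴ`. Equality of marginals on `S` makes each column of `Φ` the image of `ψ`
under an operator outside `S`, for every given `S`; it remains to see that such a column is a
multiple of `ψ`. For a pair, `ψ` is a list of at least three square matrices indexed by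
configurations of `S ∩ T`, and generic such matrices have only scalar intertwiners. For a star, `ψ`
is an injective matrix from outside `K` to `K`, so the operators for all `j` coincide; the common
operator is trivial on every party outside `K`, hence scalar. -/

noncomputable section

/-! ### Null sets in real vector spaces and on the sphere -/

section Null

variable {E : Type*} [NormedAddCommGroup E] [NormedSpace ℝ E] [FiniteDimensional ℝ E]
  [MeasurableSpace E] [BorelSpace E] (μ : Measure E) [μ.IsAddHaarMeasure]

/-- A differentiable map from a space of smaller dimension has a null image. -/
theorem addHaar_range_eq_zero_of_finrank_lt {F : Type*} [NormedAddCommGroup F] [NormedSpace ℝ F]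
    [FiniteDimensional ℝ F] (f : F → E) (hf : Differentiable ℝ f)
    (h : Module.finrank ℝ F < Module.finrank ℝ E) : μ (Set.range f) = 0 := by
  -- Precomposing `f` with a linear surjection `g : E → F` gives a self-map of `E` with the same
  -- range, whose derivative factors through `F` and so is singular everywhere; Sard's lemma
  -- applies.
  obtain ⟨i, hi⟩ : ∃ i : F →ₗ[ℝ] E, Function.Injective i := by
    rw [← lift_rank_le_iff_exists_linearMap, ← Module.finrank_eq_rank, ← Module.finrank_eq_rank]
    simp only [Cardinal.lift_natCast]
    exact_mod_cast h.le
  obtain ⟨g, hg⟩ := i.exists_leftInverse_of_injective (LinearMap.ker_eq_bot.2 hi)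
  have hsurj : Function.Surjective g := fun y => ⟨i y, LinearMap.congr_fun hg y⟩
  let g' : E →L[ℝ] F := LinearMap.toContinuousLinearMap g
  have hrange : Set.range f = (fun x => f (g x)) '' Set.univ := by
    rw [Set.image_univ]
    exact (hsurj.range_comp f).symm
  rw [hrange]
  refine addHaar_image_eq_zero_of_det_fderivWithin_eq_zero μ
    (f' := fun x => (fderiv ℝ f (g x)).comp g') (fun x _ => ?_) (fun x _ => ?_)
  · exact ((hf (g x)).hasFDerivAt.comp x g'.hasFDerivAt).hasFDerivWithinAt
  · have hker : g.ker ≠ ⊥ := LinearMap.ker_ne_bot_of_finrank_lt h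
    refine LinearMap.det_eq_zero_iff_ker_ne_bot.2 fun hbot => hker (le_bot_iff.1 ?_)
    rw [← hbot]
    intro y hy
    have : g y = 0 := hy
    simp [g', this]

/-- A linear family of linear maps which is injective at one parameter is injective at almost
every parameter. -/
theorem ae_injective_of_linear_family {V W : Type*} [AddCommGroup V] [Module ℂ V]
    [FiniteDimensional ℂ V] [AddCommGroup W] [Module ℂ W] (L : E →ₗ[ℝ] V →ₗ[ℂ] W) (p₀ : E)
    (h₀ : Function.Injective (L p₀)) : ∀ᵐ p ∂μ, Function.Injective (L p) := by
  obtain ⟨g, hg⟩ := (L p₀).exists_leftInverse_of_injective (LinearMap.ker_eq_bot.2 h₀)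
  let b := Module.finBasis ℂ V
  let s : Set E := {p | (LinearMap.toMatrix b b (g ∘ₗ L p)).det ≠ 0}
  have hcont : Continuous fun p => (LinearMap.toMatrix b b (g ∘ₗ L p)).det := by
    refine Continuous.matrix_det (continuous_matrix fun i j => ?_)
    let entry : E →ₗ[ℝ] ℂ :=
      { toFun := fun p => LinearMap.toMatrix b b (g ∘ₗ L p) i j
        map_add' := fun p q => by simp [LinearMap.toMatrix_apply]
        map_smul' := fun c p => by
          simp only [LinearMap.toMatrix_apply, map_smul, LinearMap.comp_apply,
            LinearMap.smul_apply, RingHom.id_apply]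
          rw [← algebraMap_smul ℂ c, map_smul, map_smul]
          simp }
    exact entry.continuous_of_finiteDimensional
  have hs : MeasurableSet s := (isOpen_ne_fun hcont continuous_const).measurableSet
  have hinj : ∀ p ∈ s, Function.Injective (L p) := by
    intro p hp
    have hdet : LinearMap.det (g ∘ₗ L p) ≠ 0 := by rwa [← LinearMap.det_toMatrix b]
    have hker : (g ∘ₗ L p).ker = ⊥ := by
      by_contra hne
      exact hdet (LinearMap.det_eq_zero_iff_ker_ne_bot.2 hne)
    exact Function.Injective.of_comp (LinearMap.ker_eq_bot.1 hker)
  -- It suffices to argue on each line `y + t p₀`. There `g ∘ L` equals `g ∘ L y + t`, which is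
  -- singular only if `-t` is one of finitely many eigenvalues.
  refine (ae_mem_of_ae_add_linearMap_mem (LinearMap.toSpanSingleton ℝ E p₀) volume μ hs
    fun y => ?_).mono hinj
  have hfin : {t : ℝ | Module.End.HasEigenvalue (g ∘ₗ L y) (-(t : ℂ))}.Finite :=
    (Module.End.finite_hasEigenvalue (g ∘ₗ L y)).preimage
      (fun a _ c _ hac => by simpa using hac)
  refine (hfin.countable.ae_notMem volume).mono fun t ht => ?_
  have hdet : LinearMap.det (g ∘ₗ L (y + LinearMap.toSpanSingleton ℝ E p₀ t)) ≠ 0 := by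
    intro h0
    apply ht
    obtain ⟨v, hv, hv0⟩ := (Submodule.ne_bot_iff _).1 (LinearMap.det_eq_zero_iff_ker_ne_bot.1 h0)
    refine Module.End.hasEigenvalue_of_hasEigenvector (x := v) ⟨?_, hv0⟩
    rw [Module.End.mem_eigenspace_iff]
    have hgv : g (L p₀ v) = v := LinearMap.congr_fun hg v
    have hv' : g (L (y + LinearMap.toSpanSingleton ℝ E p₀ t) v) = 0 := hv
    rw [LinearMap.toSpanSingleton_apply, map_add, map_smul, LinearMap.add_apply,
      LinearMap.smul_apply, ← algebraMap_smul ℂ t, map_add, map_smul, hgv] at hv'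
    rw [neg_smul]
    exact eq_neg_of_add_eq_zero_left hv'
  rwa [← LinearMap.det_toMatrix b] at hdet

/-- A property which holds almost everywhere and is invariant under positive scaling holds almost
everywhere on the unit sphere. -/
theorem ae_toSphere_of_ae [Nontrivial E] {P : E → Prop} (hP : ∀ᵐ x ∂μ, P x)
    (hscale : ∀ x, ∀ r : ℝ, 0 < r → P (r • x) → P x) : ∀ᵐ x ∂μ.toSphere, P x.1 := by
  let B : Set (Metric.sphere (0 : E) 1) := {x | ¬ P x.1}
  -- In polar coordinates the cone over the bad set `B` is null with measure a product; the radial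
  -- factor is nonzero, so `B` is null.
  have hpre := (Measure.measurePreserving_homeomorphUnitSphereProd μ).measure_preimage_emb
    (homeomorphUnitSphereProd E).measurableEmbedding (B ×ˢ Set.univ)
  have hzero : (μ.comap Subtype.val) (homeomorphUnitSphereProd E ⁻¹' (B ×ˢ Set.univ)) = 0 := by
    rw [(MeasurableEmbedding.subtype_coe (measurableSet_singleton (0 : E)).compl).comap_apply]
    refine measure_mono_null ?_ hP
    rintro _ ⟨x, hx, rfl⟩ hPx
    have hx0 : 0 < ‖x.1‖ := norm_pos_iff.2 x.2
    refine hx.1 (hscale _ ‖x.1‖ hx0 ?_)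
    rw [homeomorphUnitSphereProd_apply_fst_coe, smul_inv_smul₀ hx0.ne']
    exact hPx
  rw [hzero, Measure.prod_prod] at hpre
  rcases mul_eq_zero.1 hpre.symm with h | h
  · exact h
  · exfalso
    have hle := measure_mono (μ := Measure.volumeIoiPow (Module.finrank ℝ E - 1))
      (Set.subset_univ (Set.Iio (⟨1, Set.mem_Ioi.2 one_pos⟩ : Set.Ioi (0 : ℝ))))
    rw [h, Measure.volumeIoiPow_apply_Iio] at hle
    simp at hle
    norm_cast at hle

end Null

/-! ### Generic tensors: product vectors, injectivity, intertwiners -/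

section Generic

variable {E : Type*} [NormedAddCommGroup E] [NormedSpace ℝ E] [FiniteDimensional ℝ E]
  [MeasurableSpace E] [BorelSpace E] (μ : Measure E) [μ.IsAddHaarMeasure]

/-- The tensors `M` on `(I × J) × Z` for which some combination of the slices with coefficient `1`
at `i` is a product vector `a ⊗ b` with `a l = 1`, parametrized by the coefficients off `i`, the
slices off `i`, the entries of `a` off `l`, and `b`. -/
def productSliceParam {I J Z : Type*} [Fintype Z] [DecidableEq I] [DecidableEq Z] (i : Z) (l : I)
    (q : ({z // z ≠ i} → ℂ) × ({z // z ≠ i} × (I × J) → ℂ) × ({x // x ≠ l} → ℂ) × (J → ℂ)) :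
    (I × J) × Z → ℂ := fun w =>
  if h : w.2 = i then
    (if h' : w.1.1 = l then 1 else q.2.2.1 ⟨w.1.1, h'⟩) * q.2.2.2 w.1.2
      - ∑ z, q.2.1 (z, w.1) * q.1 z
  else q.2.1 (⟨w.2, h⟩, w.1)

theorem differentiable_productSliceParam {I J Z : Type*} [Fintype I] [Fintype J] [Fintype Z]
    [DecidableEq I] [DecidableEq Z] (i : Z) (l : I) :
    Differentiable ℝ (productSliceParam (J := J) i l) := by
  refine differentiable_pi.2 fun w => ?_
  unfold productSliceParam
  by_cases h : w.2 = i
  · by_cases h' : w.1.1 = l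
    · simp only [h, h', dite_true]
      fun_prop
    · simp only [h, h', dite_true, dite_false]
      fun_prop
  · simp only [h, dite_false]
    fun_prop

set_option synthInstance.maxHeartbeats 200000 in
/-- For dimensional reasons, a generic subspace of `ℂ^I ⊗ ℂ^J` of dimension at most
`(|I| - 1) (|J| - 1)` contains no product vector. -/
theorem ae_no_product_vector {I J Z : Type*} [Fintype I] [Fintype J] [Fintype Z]
    (e : E ≃ₗ[ℝ] ((I × J) × Z → ℂ))
    (hcard : Fintype.card Z + Fintype.card I + Fintype.card J
      ≤ Fintype.card I * Fintype.card J + 1) :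
    ∀ᵐ p ∂μ, ∀ (c : Z → ℂ) (a : I → ℂ) (b : J → ℂ), c ≠ 0 → a ≠ 0 →
      ¬ ∀ x y, ∑ z, e p ((x, y), z) * c z = a x * b y := by
  classical
  have hnull : ∀ (i : Z) (l : I),
      μ (Set.range fun q => e.symm (productSliceParam (J := J) i l q)) = 0 := by
    intro i l
    refine addHaar_range_eq_zero_of_finrank_lt μ _
      ((LinearMap.toContinuousLinearMap e.symm.toLinearMap).differentiable.comp
        (differentiable_productSliceParam i l)) ?_
    rw [e.finrank_eq]
    have hZ : 0 < Fintype.card Z := Fintype.card_pos_iff.2 ⟨i⟩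
    have hI : 0 < Fintype.card I := Fintype.card_pos_iff.2 ⟨l⟩
    simp only [Module.finrank_prod, Module.finrank_pi_fintype, Complex.finrank_real_complex,
      Finset.sum_const, Finset.card_univ, Fintype.card_prod, Fintype.card_subtype_compl,
      Fintype.card_unique, smul_eq_mul, ne_eq]
    -- In complex dimensions the count is `(|Z|-1) + (|Z|-1)|I||J| + (|I|-1) + |J| < |Z||I||J|`,
    -- which is exactly `hcard`.
    obtain ⟨r, hr⟩ := Nat.exists_eq_succ_of_ne_zero hZ.ne'
    obtain ⟨s, hs⟩ := Nat.exists_eq_succ_of_ne_zero hI.ne'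
    rw [hr, hs] at hcard ⊢
    simp only [Nat.succ_eq_add_one, Nat.add_sub_cancel] at hcard ⊢
    nlinarith
  have hae : ∀ᵐ p ∂μ, ∀ (i : Z) (l : I),
      p ∉ Set.range fun q => e.symm (productSliceParam (J := J) i l q) :=
    ae_all_iff.2 fun i => ae_all_iff.2 fun l => measure_eq_zero_iff_ae_notMem.1 (hnull i l)
  refine hae.mono fun p hp c a b hc ha h => ?_
  obtain ⟨i, hi⟩ := Function.ne_iff.1 hc
  obtain ⟨l, hl⟩ := Function.ne_iff.1 ha
  simp only [Pi.zero_apply] at hi hl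
  refine hp i l ⟨⟨fun z => c z / c i, fun w => e p (w.2, w.1), fun x => a x / a l,
    fun y => a l * b y / c i⟩, ?_⟩
  apply e.injective
  rw [LinearEquiv.apply_symm_apply]
  funext ⟨⟨x, y⟩, z⟩
  by_cases hz : z = i
  · subst hz
    have hx : (if h' : x = l then (1 : ℂ) else a x / a l) = a x / a l := by
      split_ifs with h'
      · rw [h', div_self hl]
      · rfl
    have hsum := h x y
    rw [Fintype.sum_eq_add_sum_subtype_ne _ z] at hsum
    simp only [productSliceParam, dite_true, hx]
    have : ∑ w : {w // w ≠ z}, e p ((x, y), w.1) * (c w.1 / c z)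
        = (a x * b y - e p ((x, y), z) * c z) / c z := by
      rw [← hsum, add_sub_cancel_left, Finset.sum_div]
      exact Finset.sum_congr rfl fun w _ => by ring
    rw [this]
    field_simp
    ring
  · simp [productSliceParam, hz]

/-- A generic matrix with at least as many rows as columns is injective. -/
theorem ae_matrix_injective {I Z : Type*} [Fintype I] [Fintype Z] (e : E ≃ₗ[ℝ] (I × Z → ℂ))
    (hcard : Fintype.card Z ≤ Fintype.card I) :
    ∀ᵐ p ∂μ, ∀ c c' : Z → ℂ,
      (∀ x, ∑ z, e p (x, z) * c z = ∑ z, e p (x, z) * c' z) → c = c' := by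
  classical
  obtain ⟨f⟩ := Function.Embedding.nonempty_of_card_le hcard
  let L : E →ₗ[ℝ] (Z → ℂ) →ₗ[ℂ] (I → ℂ) := LinearMap.mk₂' ℝ ℂ
    (fun p c x => ∑ z, e p (x, z) * c z)
    (fun p q c => by ext x; simp [add_mul, Finset.sum_add_distrib])
    (fun r p c => by ext x; simp [Finset.mul_sum, mul_assoc])
    (fun p c c' => by ext x; simp [mul_add, Finset.sum_add_distrib])
    (fun r p c => by ext x; simp [Finset.mul_sum, mul_left_comm])
  have h₀ : Function.Injective (L (e.symm fun w => if f w.2 = w.1 then 1 else 0)) := by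
    intro c c' h
    funext z
    have := congrFun h (f z)
    simpa [L, f.injective.eq_iff] using this
  exact (ae_injective_of_linear_family μ L _ h₀).mono fun p hp c c' h => hp (funext h)

/-- Three generic square matrices have only scalar simultaneous intertwiners. -/
theorem ae_intertwiner_scalar {I B : Type*} [Fintype I] [Nonempty I] [DecidableEq I] [Fintype B]
    (e : E ≃ₗ[ℝ] (I × B × I → ℂ)) (hB : 3 ≤ Fintype.card B) :
    ∀ᵐ p ∂μ, ∀ V W : Matrix I I ℂ,
      (∀ x b y, ∑ y', e p (x, b, y') * V y' y = ∑ x', e p (x', b, y) * W x' x) →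
        ∃ c : ℂ, V = c • (1 : Matrix I I ℂ) := by
  classical
  obtain ⟨b₀, b₁, b₂, h01, h02, h12⟩ := Fintype.two_lt_card_iff.1 (show 2 < Fintype.card B from hB)
  obtain ⟨i₀⟩ := ‹Nonempty I›
  -- The pair `(1, 1)` always intertwines; the last coordinate detects it, so that injectivity
  -- becomes possible. Its factor `e p` keeps `L` linear in `p`.
  let L : E →ₗ[ℝ] (Matrix I I ℂ × Matrix I I ℂ) →ₗ[ℂ] ((I → B → I → ℂ) × ℂ) :=
    LinearMap.mk₂' ℝ ℂ
      (fun p X => (fun x b y => ∑ y', e p (x, b, y') * X.1 y' y - ∑ x', e p (x', b, y) * X.2 x' x,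
        e p (i₀, b₀, i₀) * X.1 i₀ i₀))
      (fun p q c => by
        ext x <;> simp [add_mul, Finset.sum_add_distrib]; ring)
      (fun r p c => by
        ext x <;> simp [Finset.mul_sum, mul_assoc, mul_sub])
      (fun p c c' => by
        ext x <;> simp [mul_add, Finset.sum_add_distrib]; ring)
      (fun r p c => by
        ext x <;> simp [Finset.mul_sum, mul_left_comm, mul_sub])
  let v : I → ℂ := fun x => (Fintype.equivFin I x : ℕ)
  have hv : ∀ x y, v x = v y → x = y := fun x y h =>
    (Fintype.equivFin I).injective (Fin.ext (Nat.cast_injective (R := ℂ) h))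
  -- The identity forces `V = Wᵀ`, a diagonal matrix with distinct entries forces `V` diagonal, and
  -- the all-ones matrix makes its diagonal constant.
  let p₀ : E := e.symm fun w =>
    if w.2.1 = b₀ then (if w.1 = w.2.2 then 1 else 0)
    else if w.2.1 = b₁ then (if w.1 = w.2.2 then v w.1 else 0) else 1
  have h₀ : Function.Injective (L p₀) := by
    rw [← LinearMap.ker_eq_bot, LinearMap.ker_eq_bot']
    rintro ⟨V, W⟩ h
    have hfst : ∀ x b y, ∑ y', e p₀ (x, b, y') * V y' y - ∑ x', e p₀ (x', b, y) * W x' x = 0 :=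
      fun x b y => congrFun (congrFun (congrFun (congrArg Prod.fst h) x) b) y
    have hsnd : e p₀ (i₀, b₀, i₀) * V i₀ i₀ = 0 := congrArg Prod.snd h
    have hVW : ∀ x y, V x y = W y x := by
      intro x y
      have := hfst x b₀ y
      simpa [p₀, sub_eq_zero] using this
    have hoff : ∀ x y, x ≠ y → V x y = 0 := by
      intro x y hxy
      have := hfst x b₁ y
      simp [p₀, h01.symm, ← hVW, sub_eq_zero] at this
      exact this.resolve_left fun h => hxy (hv _ _ h)
    have hdiag : ∀ x y, V y y = V x x := by
      intro x y
      have := hfst x b₂ y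
      simp only [p₀, LinearEquiv.apply_symm_apply, h02.symm, h12.symm, if_false, one_mul,
        ← hVW, sub_eq_zero] at this
      rwa [Finset.sum_eq_single y (fun z _ hz => hoff z y hz) (by simp),
        Finset.sum_eq_single x (fun z _ hz => hoff x z hz.symm) (by simp)] at this
    have hzero : V i₀ i₀ = 0 := by simpa [p₀] using hsnd
    have hV : V = 0 := by
      ext x y
      by_cases hxy : x = y
      · subst hxy
        rw [hdiag i₀ x, hzero]; rfl
      · exact hoff x y hxy
    have hW : W = 0 := by
      ext x y
      rw [← hVW, hV]; rfl
    rw [hV, hW]; rfl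
  refine (ae_injective_of_linear_family μ L p₀ h₀).mono fun p hp V W h => ⟨V i₀ i₀, ?_⟩
  have hL : L p (V, W) = L p (V i₀ i₀ • 1, V i₀ i₀ • 1) := by
    refine Prod.ext ?_ ?_
    · funext x b y
      have h1 : (L p (V, W)).1 x b y = 0 := sub_eq_zero.2 (h x b y)
      rw [h1]
      simp [L, Matrix.one_apply]
    · simp [L]
  exact congrArg Prod.fst (hp hL)

end Generic

/-! ### Factorizations of positive matrices and the range criterion -/

section Factor

theorem range_mulVecLin_mul_conjTranspose {X Z : Type*} [Fintype X] [Fintype Z]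
    (V : Matrix X Z ℂ) : (V * V.conjTranspose).mulVecLin.range = V.mulVecLin.range := by
  refine Submodule.eq_of_le_of_finrank_eq ?_ V.rank_self_mul_conjTranspose
  rw [Matrix.mulVecLin_mul]
  exact LinearMap.range_comp_le_range _ _

/-- If `V Vᴴ = W Wᴴ`, then the columns of `W` are combinations of the columns of `V`. -/
theorem exists_eq_mul_of_mul_conjTranspose_eq {X Z K : Type*} [Fintype X] [Fintype Z] [Fintype K]
    {V : Matrix X Z ℂ} {W : Matrix X K ℂ} (h : V * V.conjTranspose = W * W.conjTranspose) :
    ∃ C : Matrix Z K ℂ, W = V * C := by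
  classical
  have hrange : W.mulVecLin.range = V.mulVecLin.range := by
    rw [← range_mulVecLin_mul_conjTranspose W, ← h, range_mulVecLin_mul_conjTranspose]
  have hcol : ∀ k, ∃ c : Z → ℂ, V.mulVec c = W.col k := fun k => by
    have : W.mulVecLin (Pi.single k 1) ∈ V.mulVecLin.range :=
      hrange ▸ LinearMap.mem_range_self _ _
    obtain ⟨c, hc⟩ := this
    exact ⟨c, by simpa using hc⟩
  choose C hC using hcol
  refine ⟨Matrix.of fun z k => C k z, ?_⟩
  ext x k
  exact (congrFun (hC k) x).symm

theorem Matrix.PosSemidef.exists_eq_mul_conjTranspose {X : Type*} [Fintype X]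
    {A : Matrix X X ℂ} (hA : A.PosSemidef) :
    ∃ (m : ℕ) (Φ : Matrix X (Fin m) ℂ), A = Φ * Φ.conjTranspose := by
  obtain ⟨m, v, rfl⟩ := Matrix.posSemidef_iff_eq_sum_vecMulVec.1 hA
  refine ⟨m, Matrix.of fun x k => v k x, ?_⟩
  ext x y
  simp [Matrix.mul_apply, Matrix.sum_apply, Matrix.vecMulVec_apply]

theorem IsDensityMatrix.exists_factor {X : Type*} [Fintype X] {A : Matrix X X ℂ}
    (hA : IsDensityMatrix A) :
    ∃ (m : ℕ) (Φ : Matrix X (Fin m) ℂ), A = Φ * Φ.conjTranspose ∧ ∃ x k, Φ x k ≠ 0 := by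
  obtain ⟨m, Φ, h⟩ := hA.1.exists_eq_mul_conjTranspose
  refine ⟨m, Φ, h, ?_⟩
  by_contra! h0
  have hΦ : Φ = 0 := by ext x k; exact h0 x k
  have := hA.2
  rw [h, hΦ] at this
  simp at this

/-- The range criterion: if the column space of `M` contains no product vector, then `M Mᴴ` is
not separable. -/
theorem not_isSeparableState_mul_conjTranspose {I J Z : Type*} [Fintype I] [Fintype J] [Fintype Z]
    (M : Matrix (I × J) Z ℂ)
    (hM : ∀ (c : Z → ℂ) (a : I → ℂ) (b : J → ℂ), c ≠ 0 → a ≠ 0 →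
      ¬ ∀ x y, ∑ z, M (x, y) z * c z = a x * b y) :
    ¬ IsSeparableState (M * M.conjTranspose) := by
  rintro ⟨n, p, σ, τ, hp, hp1, hσ, hτ, hρ⟩
  choose m Φ hΦ hΦ0 using fun i => (hσ i).exists_factor
  choose m' Ψ hΨ hΨ0 using fun i => (hτ i).exists_factor
  -- The columns of `W` are product vectors; one that is nonzero contradicts `hM`.
  let W : Matrix (I × J) (Σ i, Fin (m i) × Fin (m' i)) ℂ := Matrix.of fun xy k =>
    (Real.sqrt (p k.1) : ℂ) * Φ k.1 xy.1 k.2.1 * Ψ k.1 xy.2 k.2.2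
  have hW : M * M.conjTranspose = W * W.conjTranspose := by
    rw [hρ]
    ext ⟨x, y⟩ ⟨x', y'⟩
    simp only [Matrix.sum_apply, Matrix.smul_apply, Matrix.kroneckerMap_apply, smul_eq_mul,
      Matrix.mul_apply (M := W), Fintype.sum_sigma, Fintype.sum_prod_type]
    refine Finset.sum_congr rfl fun i _ => ?_
    rw [hΦ i, hΨ i, Matrix.mul_apply, Matrix.mul_apply, Finset.sum_mul_sum, Finset.mul_sum]
    refine Finset.sum_congr rfl fun k _ => ?_
    rw [Finset.mul_sum]
    refine Finset.sum_congr rfl fun l _ => ?_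
    have hs : (p i : ℂ) = (Real.sqrt (p i) : ℂ) * (Real.sqrt (p i) : ℂ) := by
      rw [← Complex.ofReal_mul, Real.mul_self_sqrt (hp i)]
    simp only [W, Matrix.of_apply, Matrix.conjTranspose_apply, star_mul', Complex.star_def,
      Complex.conj_ofReal]
    rw [hs]
    ring
  obtain ⟨C, hC⟩ := exists_eq_mul_of_mul_conjTranspose_eq hW
  obtain ⟨i, hi⟩ : ∃ i, p i ≠ 0 := by
    by_contra! h0
    simp [h0] at hp1
  have hsqrt : (Real.sqrt (p i) : ℂ) ≠ 0 := by
    exact_mod_cast (Real.sqrt_pos.2 (lt_of_le_of_ne (hp i) hi.symm)).ne'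
  obtain ⟨x, k, hx⟩ := hΦ0 i
  obtain ⟨y, l, hy⟩ := hΨ0 i
  have hsum : ∀ x y, ∑ z, M (x, y) z * C z ⟨i, k, l⟩
      = ((Real.sqrt (p i) : ℂ) * Φ i x k) * Ψ i y l := fun x y =>
    (congrFun (congrFun hC (x, y)) ⟨i, k, l⟩).symm
  refine hM (fun z => C z ⟨i, k, l⟩) (fun x => Real.sqrt (p i) * Φ i x k) (fun y => Ψ i y l)
    (fun h0 => ?_) (fun h0 => ?_) hsum
  · have := hsum x y
    rw [Finset.sum_eq_zero fun z _ => by rw [show C z ⟨i, k, l⟩ = 0 from congrFun h0 z, mul_zero]]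
      at this
    exact mul_ne_zero (mul_ne_zero hsqrt hx) hy this.symm
  · exact mul_ne_zero hsqrt hx (congrFun h0 x)

end Factor

/-! ### Uniqueness and entanglement criteria for a pure state -/

section Pure

variable {N d : ℕ}

theorem sum_mul_star_eq_one {ψ : QuditSpace N d} (hψ : ‖ψ‖ = 1) : ∑ x, ψ x * star (ψ x) = 1 := by
  have h := EuclideanSpace.norm_sq_eq ψ
  rw [hψ] at h
  simp only [Complex.star_def, Complex.mul_conj, Complex.normSq_eq_norm_sq]
  exact_mod_cast (by simpa using h.symm)

theorem isDensityMatrix_pureDensity {ψ : QuditSpace N d} (hψ : ‖ψ‖ = 1) :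
    IsDensityMatrix (pureDensity ψ) :=
  ⟨Matrix.posSemidef_vecMulVec_self_star (ψ : (Fin N → Fin d) → ℂ), sum_mul_star_eq_one hψ⟩

/-- `φ` arises from `ψ` by an operator acting on the parties outside `S`. -/
def ObtainedOutside (S : Finset (Fin N)) (ψ φ : (Fin N → Fin d) → ℂ) : Prop :=
  ∃ V : Matrix ({i // i ∉ S} → Fin d) ({i // i ∉ S} → Fin d) ℂ, ∀ x z,
    φ ((splitEquiv d S).symm (x, z)) = ∑ z', ψ ((splitEquiv d S).symm (x, z')) * V z' z

/-- A pure state is determined by its marginals on `G` among all states if every vector obtained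
from it by operators acting outside `S`, for each `S ∈ G`, is a multiple of it. -/
theorem eq_pureDensity_of_isCompatible {ψ : QuditSpace N d} (hψ : ‖ψ‖ = 1)
    {G : Finset (Finset (Fin N))}
    (hG : ∀ φ : (Fin N → Fin d) → ℂ, (∀ S ∈ G, ObtainedOutside S ψ φ) →
      ∃ c : ℂ, ∀ x, φ x = c * ψ x)
    {η : Matrix (Fin N → Fin d) (Fin N → Fin d) ℂ}
    (hη : IsCompatible G (fun Q => marginal Q (pureDensity ψ)) η) : η = pureDensity ψ := by
  obtain ⟨⟨hpos, htr⟩, hmarg⟩ := hη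
  obtain ⟨m, Φ, rfl⟩ := hpos.exists_eq_mul_conjTranspose
  have hcol : ∀ k, ∃ c : ℂ, ∀ x, Φ x k = c * ψ x := by
    intro k
    refine hG (fun x => Φ x k) fun S hS => ?_
    let M : Matrix ({i // i ∈ S} → Fin d) ({i // i ∉ S} → Fin d) ℂ :=
      Matrix.of fun x z => ψ ((splitEquiv d S).symm (x, z))
    -- The purifying index is traced out together with the parties outside `S`; fixing it in `W = M
    -- * C` leaves an operator outside `S`.
    let W : Matrix ({i // i ∈ S} → Fin d) (({i // i ∉ S} → Fin d) × Fin m) ℂ :=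
      Matrix.of fun x z => Φ ((splitEquiv d S).symm (x, z.1)) z.2
    have hMW : M * M.conjTranspose = W * W.conjTranspose := by
      have h1 : marginal S (pureDensity ψ) = M * M.conjTranspose := rfl
      have h2 : marginal S (Φ * Φ.conjTranspose) = W * W.conjTranspose := by
        ext x y
        simp only [marginal, Matrix.mul_apply, Fintype.sum_prod_type]
        rfl
      rw [← h1, ← h2]
      exact (hmarg S hS).symm
    obtain ⟨C, hC⟩ := exists_eq_mul_of_mul_conjTranspose_eq hMW
    exact ⟨Matrix.of fun z' z => C z' (z, k), fun x z => congrFun (congrFun hC x) (z, k)⟩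
  choose c hc using hcol
  have hentry : ∀ x y, (Φ * Φ.conjTranspose) x y
      = (∑ k, c k * star (c k)) * (ψ x * star (ψ y)) := by
    intro x y
    rw [Matrix.mul_apply, Finset.sum_mul]
    refine Finset.sum_congr rfl fun k _ => ?_
    rw [Matrix.conjTranspose_apply, hc, hc, star_mul']
    ring
  have hone : ∑ k, c k * star (c k) = 1 := by
    have : (Φ * Φ.conjTranspose).trace = (∑ k, c k * star (c k)) * ∑ x, ψ x * star (ψ x) := by
      rw [Finset.mul_sum]
      exact Finset.sum_congr rfl fun x _ => hentry x x
    rw [htr, sum_mul_star_eq_one hψ, mul_one] at this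
    exact this.symm
  ext x y
  rw [hentry, hone, one_mul]
  rfl

theorem entangledAcross_marginal_pureDensity (ψ : QuditSpace N d) (R : Finset (Fin N))
    (A : Finset {i // i ∈ R})
    (h : ∀ (c : ({i // i ∉ R} → Fin d) → ℂ) (a : ({i // i ∈ A} → Fin d) → ℂ)
      (b : ({i // i ∉ A} → Fin d) → ℂ), c ≠ 0 → a ≠ 0 →
      ¬ ∀ x y, ∑ z, ψ ((splitEquiv d R).symm ((splitEquiv d A).symm (x, y), z)) * c z
        = a x * b y) :
    EntangledAcross (marginal R (pureDensity ψ)) A :=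
  not_isSeparableState_mul_conjTranspose
    (Matrix.of fun xy z => ψ ((splitEquiv d R).symm ((splitEquiv d A).symm xy, z))) h

end Pure

/-! ### Uniqueness from two marginals -/

section TwoSets

variable {N d : ℕ} {S T : Finset (Fin N)}

/-- The configurations of all parties in terms of those outside `T`, in `S ∩ T`, outside `S`. -/
def tripleEquiv (d : ℕ) (hST : ∀ i, i ∈ S ∨ i ∈ T) :
    ({i // i ∉ T} → Fin d) × ({i // i ∈ S ∩ T} → Fin d) × ({i // i ∉ S} → Fin d)
      ≃ (Fin N → Fin d) where
  toFun w i :=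
    if hT : i ∉ T then w.1 ⟨i, hT⟩
    else if hS : i ∉ S then w.2.2 ⟨i, hS⟩
    else w.2.1 ⟨i, mem_inter.2 ⟨not_not.1 hS, not_not.1 hT⟩⟩
  invFun x := (fun i => x i, fun i => x i, fun i => x i)
  left_inv w := by
    refine Prod.ext (funext fun i => ?_) (Prod.ext (funext fun i => ?_) (funext fun i => ?_))
    · simp [i.2]
    · simp [(mem_inter.1 i.2).1, (mem_inter.1 i.2).2]
    · simp [i.2, (hST i).resolve_left i.2]
  right_inv x := by
    funext i
    dsimp only
    split_ifs <;> rfl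

theorem splitEquiv_symm_tripleEquiv_left (hST : ∀ i, i ∈ S ∨ i ∈ T) (a : {i // i ∉ T} → Fin d)
    (b : {i // i ∈ S ∩ T} → Fin d) (c c' : {i // i ∉ S} → Fin d) :
    (splitEquiv d S).symm (fun i => tripleEquiv d hST (a, b, c) i, c')
      = tripleEquiv d hST (a, b, c') := by
  funext i
  have := hST i
  by_cases hS : i ∈ S <;> by_cases hT : i ∈ T <;>
    simp_all [splitEquiv, tripleEquiv, Equiv.piEquivPiSubtypeProd]

theorem splitEquiv_symm_tripleEquiv_right (hST : ∀ i, i ∈ S ∨ i ∈ T) (a a' : {i // i ∉ T} → Fin d)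
    (b : {i // i ∈ S ∩ T} → Fin d) (c : {i // i ∉ S} → Fin d) :
    (splitEquiv d T).symm (fun i => tripleEquiv d hST (a, b, c) i, a')
      = tripleEquiv d hST (a', b, c) := by
  funext i
  have := hST i
  by_cases hS : i ∈ S <;> by_cases hT : i ∈ T <;>
    simp_all [splitEquiv, tripleEquiv, Equiv.piEquivPiSubtypeProd]

/-- Equating the two expressions for `φ` gives the intertwining relation of `hψ`; the relabelling
`f` makes the slices square. -/
theorem eq_smul_of_obtainedOutside_pair (hST : ∀ i, i ∈ S ∨ i ∈ T)
    (f : ({i // i ∉ T} → Fin d) ≃ ({i // i ∉ S} → Fin d)) {ψ φ : (Fin N → Fin d) → ℂ}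
    (hψ : ∀ V W : Matrix ({i // i ∉ T} → Fin d) ({i // i ∉ T} → Fin d) ℂ,
      (∀ x b y, ∑ y', ψ (tripleEquiv d hST (x, b, f y')) * V y' y
        = ∑ x', ψ (tripleEquiv d hST (x', b, f y)) * W x' x) → ∃ c : ℂ, V = c • 1)
    (hS : ObtainedOutside S ψ φ) (hT : ObtainedOutside T ψ φ) : ∃ c : ℂ, ∀ x, φ x = c * ψ x := by
  obtain ⟨V, hV⟩ := hS
  obtain ⟨W, hW⟩ := hT
  have hV' : ∀ a b c, φ (tripleEquiv d hST (a, b, c))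
      = ∑ c', ψ (tripleEquiv d hST (a, b, c')) * V c' c := by
    intro a b c
    have := hV (fun i => tripleEquiv d hST (a, b, c) i) c
    simpa only [splitEquiv_symm_tripleEquiv_left] using this
  have hW' : ∀ a b c, φ (tripleEquiv d hST (a, b, c))
      = ∑ a', ψ (tripleEquiv d hST (a', b, c)) * W a' a := by
    intro a b c
    have := hW (fun i => tripleEquiv d hST (a, b, c) i) a
    simpa only [splitEquiv_symm_tripleEquiv_right] using this
  obtain ⟨c, hc⟩ := hψ (V.submatrix f f) W fun x b y => by
    rw [← hW', hV', ← f.sum_comp]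
    rfl
  refine ⟨c, fun x => ?_⟩
  obtain ⟨⟨a, b, z⟩, rfl⟩ := (tripleEquiv d hST).surjective x
  obtain ⟨y, rfl⟩ := f.surjective z
  rw [hV', ← f.sum_comp]
  have hc' : ∀ y', V (f y') (f y) = (c • (1 : Matrix _ _ ℂ)) y' y := fun y' =>
    congrFun (congrFun hc y') y
  simp only [hc', Matrix.smul_apply, Matrix.one_apply, smul_eq_mul, mul_ite, mul_one, mul_zero,
    Finset.sum_ite_eq', Finset.mem_univ, if_true]
  exact mul_comm _ _

end TwoSets

/-! ### Uniqueness from marginals sharing a common core -/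

section Star

variable {N d : ℕ} {K : Finset (Fin N)}

/-- An operator acting outside `K ∪ {j}`, seen as an operator outside `K`, is trivial on `j`. -/
theorem ObtainedOutside.exists_trivial_at {j : {i // i ∉ K}} {ψ φ : (Fin N → Fin d) → ℂ}
    (h : ObtainedOutside (insert j.1 K) ψ φ) :
    ∃ X : Matrix ({i // i ∉ K} → Fin d) ({i // i ∉ K} → Fin d) ℂ,
      (∀ x z, φ ((splitEquiv d K).symm (x, z))
        = ∑ z', ψ ((splitEquiv d K).symm (x, z')) * X z' z) ∧
      (∀ z' z, z' j ≠ z j → X z' z = 0) ∧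
      ∀ z a, X (Function.update z j a) (Function.update z j a) = X z z := by
  obtain ⟨V, hV⟩ := h
  let res (z : {i // i ∉ K} → Fin d) : {i // i ∉ insert j.1 K} → Fin d :=
    fun i => z ⟨i, fun hi => i.2 (mem_insert_of_mem hi)⟩
  let fill (z : {i // i ∉ K} → Fin d) (w : {i // i ∉ insert j.1 K} → Fin d) :
      {i // i ∉ K} → Fin d := fun i => if h : i.1 ∉ insert j.1 K then w ⟨i, h⟩ else z i
  have hres : ∀ z w, res (fill z w) = w := fun z w => by
    funext i
    exact dif_pos i.2
  have hextj : ∀ z w, fill z w j = z j := fun z w => by simp [fill]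
  have hext : ∀ z z', z' j = z j → fill z (res z') = z' := fun z z' hz => by
    funext i
    by_cases hi : i.1 ∉ insert j.1 K
    · exact dif_pos hi
    · have hij : i = j :=
        Subtype.ext ((mem_insert.1 (not_not.1 hi)).resolve_right i.2)
      rw [hij, hextj, hz]
  -- This is `V` tensored with the identity on party `j`.
  refine ⟨Matrix.of fun z' z => if z' j = z j then V (res z') (res z) else 0, fun x z => ?_,
    fun z' z hz => by simp [hz], fun z a => ?_⟩
  · have hglue : ∀ w, (splitEquiv d (insert j.1 K)).symm
        (fun i => (splitEquiv d K).symm (x, z) i, w) = (splitEquiv d K).symm (x, fill z w) := by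
      intro w
      funext i
      by_cases hi : i ∈ insert j.1 K <;> by_cases hK : i ∈ K <;>
        simp_all [splitEquiv, Equiv.piEquivPiSubtypeProd, fill]
    have hφ := hV (fun i => (splitEquiv d K).symm (x, z) i) (res z)
    simp only [hglue] at hφ
    rw [hext z z rfl] at hφ
    rw [hφ]
    refine Fintype.sum_of_injective (fill z) (fun w w' hw => ?_) _ _ (fun z' hz' => ?_)
      (fun w => ?_)
    · rw [← hres z w, hw, hres]
    · have : z' j ≠ z j := fun hj => hz' ⟨res z', hext z z' hj⟩
      simp [this]
    · simp [hextj, hres]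
  · have : res (Function.update z j a) = res z := by
      funext i
      refine Function.update_of_ne (fun hij => ?_) _ _
      exact i.2 (mem_insert.2 (Or.inl (congrArg Subtype.val hij)))
    simp [this]

/-- The coordinates are changed one at a time. -/
theorem eq_of_forall_update_eq {ι α β : Type*} [Fintype ι] [DecidableEq ι] (f : (ι → α) → β)
    (hf : ∀ z j a, f (Function.update z j a) = f z) (z z' : ι → α) : f z = f z' := by
  have h : ∀ s : Finset ι, f (s.piecewise z z') = f z' := by
    intro s
    induction s using Finset.induction_on with
    | empty => rw [Finset.piecewise_empty]
    | insert j s _ ih => rw [Finset.piecewise_insert, hf, ih]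
  simpa using h univ

theorem eq_smul_of_obtainedOutside_star (hK : Kᶜ.Nonempty) {ψ φ : (Fin N → Fin d) → ℂ}
    (hψ : ∀ c c' : ({i // i ∉ K} → Fin d) → ℂ,
      (∀ x, ∑ z, ψ ((splitEquiv d K).symm (x, z)) * c z
        = ∑ z, ψ ((splitEquiv d K).symm (x, z)) * c' z) → c = c')
    (h : ∀ S ∈ Kᶜ.image fun j => insert j K, ObtainedOutside S ψ φ) :
    ∃ c : ℂ, ∀ x, φ x = c * ψ x := by
  choose X hX hX0 hXu using fun j : {i // i ∉ K} =>
    (h (insert j.1 K) (mem_image_of_mem _ (mem_compl.2 j.2))).exists_trivial_at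
  obtain ⟨k, hk⟩ := hK
  let j₀ : {i // i ∉ K} := ⟨k, mem_compl.1 hk⟩
  have hXX : ∀ j, X j = X j₀ := by
    intro j
    ext z' z
    refine congrFun (hψ (fun z' => X j z' z) (fun z' => X j₀ z' z) fun x => ?_) z'
    rw [← hX, ← hX]
  by_cases hd : Nonempty ({i // i ∉ K} → Fin d)
  · obtain ⟨z₀⟩ := hd
    have hdiag : ∀ z, X j₀ z z = X j₀ z₀ z₀ := fun z =>
      eq_of_forall_update_eq (fun z => X j₀ z z) (fun z j a => by
        have := hXu j z a
        rwa [hXX j] at this) z z₀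
    have hoff : ∀ z' z, z' ≠ z → X j₀ z' z = 0 := by
      intro z' z hz
      obtain ⟨j, hj⟩ := Function.ne_iff.1 hz
      rw [← hXX j]
      exact hX0 j z' z hj
    refine ⟨X j₀ z₀ z₀, fun w => ?_⟩
    obtain ⟨⟨x, z⟩, rfl⟩ := (splitEquiv d K).symm.surjective w
    rw [hX j₀, Finset.sum_eq_single z (fun z' _ hz => by rw [hoff z' z hz, mul_zero]) (by simp),
      hdiag, mul_comm]
  · exact ⟨0, fun w => (hd ⟨fun i => w i⟩).elim⟩

end Star

/-! ### Almost sure statements for Haar-random states -/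

section Haar

variable {N d : ℕ}

theorem ae_haarPureState_of_ae (hd : 2 ≤ d) {P : QuditSpace N d → Prop}
    (hP : ∀ᵐ ψ ∂(volume : Measure (QuditSpace N d)), P ψ)
    (hscale : ∀ ψ, ∀ r : ℝ, 0 < r → P (r • ψ) → P ψ) : ∀ᵐ ψ ∂haarPureState N d, P ψ.1 := by
  have : NeZero d := ⟨by omega⟩
  have : Nontrivial (QuditSpace N d) := inferInstance
  exact Measure.ae_smul_measure (ae_toSphere_of_ae volume hP hscale) _

/-- The coordinates of a vector in a relabelled basis. -/
def quditCoords {X : Type*} (f : X ≃ (Fin N → Fin d)) : QuditSpace N d ≃ₗ[ℝ] (X → ℂ) :=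
  (WithLp.linearEquiv 2 ℝ ((Fin N → Fin d) → ℂ)).trans (LinearEquiv.funCongrLeft ℝ ℂ f)

/-- This is `d^c ≤ (d^a - 1)(d^b - 1)`. The threshold gives `c ≤ a + b - 2` for qubits and `c ≤ a +
b - 1` for `d ≥ 3`; the latter would fail for `d = 2`, `a = 1`, where the first factor is `1`. -/
theorem pow_add_pow_add_pow_le {d a b c N : ℕ} (hd : 2 ≤ d) (ha : 1 ≤ a) (hb : 1 ≤ b)
    (hN : a + b + c = N) (h : SizeThreshold d N (a + b)) :
    d ^ c + d ^ a + d ^ b ≤ d ^ a * d ^ b + 1 := by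
  obtain ⟨a, rfl⟩ := Nat.exists_eq_add_of_le' ha
  obtain ⟨b, rfl⟩ := Nat.exists_eq_add_of_le' hb
  have hx : 1 ≤ d ^ a := Nat.one_le_pow _ _ (by omega)
  have hy : 1 ≤ d ^ b := Nat.one_le_pow _ _ (by omega)
  have hxy : d ^ a + d ^ b ≤ d ^ a * d ^ b + 1 := by nlinarith
  unfold SizeThreshold at h
  split_ifs at h with h2
  · have hc : d ^ c ≤ d ^ a * d ^ b := by
      rw [← pow_add]
      exact Nat.pow_le_pow_right (by omega) (by omega)
    rw [pow_succ, pow_succ]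
    generalize d ^ a = x at *
    generalize d ^ b = y at *
    subst h2
    nlinarith
  · have hc : d ^ c ≤ d ^ a * d ^ b * d := by
      rw [← pow_add, ← pow_succ]
      exact Nat.pow_le_pow_right (by omega) (by omega)
    rw [pow_succ, pow_succ]
    generalize d ^ a = x at *
    generalize d ^ b = y at *
    have h3 : 3 ≤ d := by omega
    have h4 : 3 * (d * (x * y)) ≤ d * (d * (x * y)) := Nat.mul_le_mul_right _ h3
    have h5 : d * (x + y) ≤ d * (x * y + 1) := Nat.mul_le_mul_left _ hxy
    have h6 : d * 1 ≤ d * (x * y) := Nat.mul_le_mul_left _ (Nat.mul_pos hx hy)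
    nlinarith

/-- Almost surely, all large marginals of a random pure state are entangled across all cuts. -/
theorem ae_entangledAcrossAllCuts (hd : 2 ≤ d) :
    ∀ᵐ ψ ∂haarPureState N d, ∀ R : Finset (Fin N), SizeThreshold d N R.card →
      EntangledAcrossAllCuts (marginal R (pureDensity ψ.1)) := by
  refine ae_all_iff.2 fun R => Filter.eventually_imp_distrib_left.2 fun hR =>
    ae_all_iff.2 fun A => Filter.eventually_imp_distrib_left.2 fun hA =>
      Filter.eventually_imp_distrib_left.2 fun hA' => ?_
  let f := ((splitEquiv d R).trans ((splitEquiv d A).prodCongr (Equiv.refl _))).symm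
  have hcard := pow_add_pow_add_pow_le (a := A.card) (b := Aᶜ.card) (c := Rᶜ.card) (N := N) hd
    hA.card_pos (Finset.card_pos.2 (by
      rw [Finset.nonempty_iff_ne_empty]
      exact fun h => hA' (compl_eq_empty_iff _ |>.1 h)))
    (by
      rw [card_add_card_compl, Fintype.card_coe, card_add_card_compl, Fintype.card_fin])
    (by rwa [card_add_card_compl, Fintype.card_coe])
  have hae := ae_no_product_vector volume (quditCoords f) (by
    simp only [Fintype.card_fun, Fintype.card_fin, Fintype.card_subtype_compl, Fintype.card_coe]
    simpa only [card_compl, Fintype.card_coe, Fintype.card_fin] using hcard)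
  refine (ae_haarPureState_of_ae hd hae ?_).mono fun ψ hψ =>
    entangledAcross_marginal_pureDensity ψ.1 R A hψ
  intro ψ r hr h c a b hc ha hab
  refine h c (fun x => r * a x) b hc (fun h0 => ha ?_) fun x y => ?_
  · funext x
    have := congrFun h0 x
    simpa [hr.ne'] using this
  · rw [mul_assoc, ← hab, Finset.mul_sum]
    refine Finset.sum_congr rfl fun z _ => ?_
    simp [mul_assoc]

theorem exhibitsTransitivity_of_unique {G : Finset (Finset (Fin N))} {ψ : QuditSpace N d}
    (hψ : ‖ψ‖ = 1) (hG : ∀ S ∈ G, SizeThreshold d N S.card)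
    (hent : ∀ R : Finset (Fin N), SizeThreshold d N R.card →
      EntangledAcrossAllCuts (marginal R (pureDensity ψ)))
    (huniq : ∀ φ : (Fin N → Fin d) → ℂ, (∀ S ∈ G, ObtainedOutside S ψ φ) →
      ∃ c : ℂ, ∀ x, φ x = c * ψ x) :
    ExhibitsTransitivity G (fun Q => marginal Q (pureDensity ψ)) (remainingLarge d G) where
  compatible := ⟨pureDensity ψ, isDensityMatrix_pureDensity hψ, fun _ _ => rfl⟩
  given_entangled S hS := hent S (hG S hS)
  forced_entangled η hη R hR := by
    rw [eq_pureDensity_of_isCompatible hψ huniq hη]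
    exact hent R hR.2

theorem ae_exhibitsTransitivity_pair (hd : 2 ≤ d) {S T : Finset (Fin N)}
    (hST : ∀ i, i ∈ S ∨ i ∈ T) (hcard : S.card = T.card) (hB : 3 ≤ d ^ (S ∩ T).card)
    (hlarge : SizeThreshold d N S.card) :
    ∀ᵐ ψ ∂haarPureState N d, ExhibitsTransitivity {S, T}
      (fun Q => marginal Q (pureDensity ψ.1)) (remainingLarge d {S, T}) := by
  have : NeZero d := ⟨by omega⟩
  let f : ({i // i ∉ T} → Fin d) ≃ ({i // i ∉ S} → Fin d) := Fintype.equivOfCardEq (by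
    simp [Fintype.card_subtype_compl, hcard])
  let g := ((Equiv.refl ({i // i ∉ T} → Fin d)).prodCongr
    ((Equiv.refl ({i // i ∈ S ∩ T} → Fin d)).prodCongr f)).trans (tripleEquiv d hST)
  have hae := ae_intertwiner_scalar volume (quditCoords g) (by
    rwa [Fintype.card_fun, Fintype.card_fin, Fintype.card_coe])
  filter_upwards [ae_entangledAcrossAllCuts hd, ae_haarPureState_of_ae hd hae (by
    intro ψ r hr h V W hVW
    refine h V W fun x b y => ?_
    simpa only [map_smul, Pi.smul_apply, smul_mul_assoc, ← Finset.smul_sum]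
      using congrArg (r • ·) (hVW x b y))] with ψ hent hψ
  refine exhibitsTransitivity_of_unique (mem_sphere_zero_iff_norm.1 ψ.2) ?_ hent fun φ hφ => ?_
  · intro Q hQ
    rcases mem_insert.1 hQ with rfl | hQ
    · exact hlarge
    · rw [mem_singleton.1 hQ, ← hcard]
      exact hlarge
  · exact eq_smul_of_obtainedOutside_pair hST f hψ (hφ S (by simp)) (hφ T (by simp))

theorem ae_exhibitsTransitivity_star (hd : 2 ≤ d) {K : Finset (Fin N)} (hK : Kᶜ.Nonempty)
    (hcard : Kᶜ.card ≤ K.card) :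
    ∀ᵐ ψ ∂haarPureState N d, ExhibitsTransitivity (Kᶜ.image fun j => insert j K)
      (fun Q => marginal Q (pureDensity ψ.1))
      (remainingLarge d (Kᶜ.image fun j => insert j K)) := by
  have hsum := card_add_card_compl K
  rw [Fintype.card_fin] at hsum
  have hae := ae_matrix_injective volume (quditCoords (splitEquiv d K).symm) (by
    simp only [Fintype.card_fun, Fintype.card_fin, Fintype.card_subtype_compl, Fintype.card_coe]
    exact Nat.pow_le_pow_right (by omega) (by omega))
  filter_upwards [ae_entangledAcrossAllCuts hd, ae_haarPureState_of_ae hd hae (by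
    intro ψ r hr h c c' hcc
    refine h c c' fun x => ?_
    simpa only [map_smul, Pi.smul_apply, smul_mul_assoc, ← Finset.smul_sum]
      using congrArg (r • ·) (hcc x))] with ψ hent hψ
  refine exhibitsTransitivity_of_unique (mem_sphere_zero_iff_norm.1 ψ.2) ?_ hent fun φ hφ =>
    eq_smul_of_obtainedOutside_star hK hψ hφ
  intro Q hQ
  obtain ⟨j, hj, rfl⟩ := mem_image.1 hQ
  rw [card_insert_of_notMem (mem_compl.1 hj)]
  unfold SizeThreshold
  -- `N ≤ 2 |K|` gives `N + 2 ≤ 2 (|K| + 1)`, enough for either threshold.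
  split_ifs <;> omega

end Haar

end

theorem theorem3 (N d : ℕ) (hN : 3 ≤ N) (hd : 2 ≤ d) :
    ((3 ≤ d ∨ Even N) →
      ∀ S T : Finset (Fin N), S.card = N / 2 + 1 → T.card = N / 2 + 1 →
        (S ∩ T).card = (if Even N then 2 else 1) →
        ∀ᵐ ψ ∂(haarPureState N d),
          ExhibitsTransitivity {S, T} (fun Q => marginal Q (pureDensity ψ.1))
            (remainingLarge d {S, T})) ∧
    (∀ K : Finset (Fin N), K.card = (N + 1) / 2 →
      ∀ᵐ ψ ∂(haarPureState N d),
        ExhibitsTransitivity (Kᶜ.image fun j => insert j K)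
          (fun Q => marginal Q (pureDensity ψ.1))
          (remainingLarge d (Kᶜ.image fun j => insert j K))) := by
  refine ⟨fun hdN S T hS hT hST => ?_, fun K hK => ?_⟩
  -- The prescribed overlap is exactly `|S| + |T| - N`, so the two sets cover all parties.
  · have hunion : S ∪ T = univ := by
      rw [← card_eq_iff_eq_univ, Fintype.card_fin]
      have := card_union_add_card_inter S T
      rw [hST] at this
      split_ifs at this with h
      · obtain ⟨m, rfl⟩ := h
        omega
      · obtain ⟨m, rfl⟩ := Nat.not_even_iff_odd.1 h
        omega
    refine ae_exhibitsTransitivity_pair hd (fun i => mem_union.1 (hunion ▸ mem_univ i))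
      (hS.trans hT.symm) ?_ ?_
    -- Three slices are available: `d² ≥ 4` for even `N`, and `d ≥ 3` for odd `N`.
    · rw [hST]
      split_ifs with h
      · nlinarith
      · simpa using hdN.resolve_right h
    · rw [hS]
      unfold SizeThreshold
      split_ifs with h
      · obtain ⟨m, rfl⟩ := hdN.resolve_left (by omega)
        omega
      · omega
  · have hsum := card_add_card_compl K
    rw [Fintype.card_fin] at hsum
    exact ae_exhibitsTransitivity_star hd (card_pos.1 (by omega)) (by omega)
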